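/- All digraphs are finite and strict (no loops and no parallel arcs; a pair of opposite arcs $(u,v),(v,u)$ is allowed). Two vertices $u,v$ of a digraph are adjacent if at least one of $(u,v)$, $(v,u)$ is an arc. A closed ditrail of $D$ is a closed directed walk of $D$ in which no arc is repeated (vertices may be repeated). For $S\subseteq V(D)$ let $D\langle S\rangle$ be the subdigraph of $D$ induced by $S$. Say that $D$ is $S$-strictly strong if there are two distinct nonadjacent vertices $u,v\in S$ such that $D$ contains a closed ditrail through $u$ and $v$, and that $S$ is closed-trailable in $D$ if $D$ contains a closed ditrail through all vertices of $S$. For a digraph $H$, let $\delta^0(H)=\min_{v\in V(H)}\min\{d_H^+(v),d_H^-(v)\}$ be its minimum semi-degree, and let $\alpha'(H)$ be its matching number, that is, the maximum size of a matching in the underlying simple graph of $H$. Let $D$ be a digraph and let $S\subseteq V(D)$. If $D$ is $S$-strictly strong and $$\delta^0(D\langle S\rangle)\ \ge\ \alpha'(D\langle S\rangle)\ >\ 0,$$ then $S$ is closed-trailable in $D$. -/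

import Mathlib

namespace Digraph

variable {V : Type*}

/-- A strict digraph: no loops. (Parallel arcs are excluded by the type `Digraph`, since the arcs
are ordered pairs of vertices.) -/
def IsStrict (D : Digraph V) : Prop := ∀ v, ¬ D.Adj v v

/-- The subdigraph `D⟨S⟩` induced by `S`: vertex set `S`, and all arcs of `D` with both ends
in `S`. -/
def induced (D : Digraph V) (S : Set V) : Digraph S where
  Adj u v := D.Adj u v

/-- The out-neighbourhood `N⁺(v)`. -/
def outNbhd (D : Digraph V) (v : V) : Set V := {u | u ≠ v ∧ D.Adj v u}

/-- The in-neighbourhood `N⁻(v)`. -/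
def inNbhd (D : Digraph V) (v : V) : Set V := {u | u ≠ v ∧ D.Adj u v}

/-- The out-degree `d⁺(v)`. -/
noncomputable def outDeg (D : Digraph V) (v : V) : ℕ := (D.outNbhd v).ncard

/-- The in-degree `d⁻(v)`. -/
noncomputable def inDeg (D : Digraph V) (v : V) : ℕ := (D.inNbhd v).ncard

/-- The minimum semi-degree `δ⁰(D)`: the smaller of the minimum out-degree and the minimum
in-degree. -/
noncomputable def minSemiDeg (D : Digraph V) : ℕ := min (⨅ v, D.outDeg v) (⨅ v, D.inDeg v)

/-- The matching number `α'(D)`: the largest number of edges in a matching of the underlying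
graph of `D`. -/
noncomputable def matchingNumber (D : Digraph V) : ℕ :=
  sSup {n | ∃ M : D.toSimpleGraphInclusive.Subgraph, M.IsMatching ∧ M.edgeSet.ncard = n}

/-- `l = [v₁, …, vₖ]` is the vertex sequence of a ditrail: each `(vᵢ, vᵢ₊₁)` is an arc, and these
arcs are pairwise distinct. Vertices may be repeated. -/
structure IsDitrail (D : Digraph V) (l : List V) : Prop where
  ne_nil : l ≠ []
  isChain : l.IsChain D.Adj
  arcs_nodup : (l.zip l.tail).Nodup

/-- A closed ditrail: a ditrail whose initial and terminal vertices coincide; the vertex sequence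
is written as `[v₁, …, vₖ, v₁]`. -/
structure IsClosedDitrail (D : Digraph V) (l : List V) : Prop extends D.IsDitrail l where
  closed : l.head? = l.getLast?

/-- `D` is `S`-strictly strong: some closed ditrail of `D` passes through two distinct nonadjacent
vertices of `S`. -/
def IsStrictlyStrong (D : Digraph V) (S : Set V) : Prop :=
  ∃ u ∈ S, ∃ v ∈ S, u ≠ v ∧ ¬ D.Adj u v ∧ ¬ D.Adj v u ∧
    ∃ l, D.IsClosedDitrail l ∧ u ∈ l ∧ v ∈ l

/-- `S` is closed-trailable in `D`: some closed ditrail of `D` passes through all vertices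
of `S`. -/
def IsClosedTrailable (D : Digraph V) (S : Set V) : Prop :=
  ∃ l, D.IsClosedDitrail l ∧ ∀ s ∈ S, s ∈ l

end Digraph

/-! Let `k` be the matching number of `D⟨S⟩` and fix a maximum matching. The proof splits on how
many vertices of `S` it leaves uncovered.

At most one: then `|S| ≤ 2k + 1`, and `D⟨S⟩` itself has a spanning closed ditrail
(`exists_spanning_isClosedDitrail`). A closed ditrail with the most vertices has more than `k` of
them. If it missed some vertex, a longest path outside it could be spliced in, and counting the
attachment vertices at its two ends gives more than `2k + 1` vertices.

Two, `x` and `y`: since the matching has no augmenting path, each of its edges receives at most two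
edges from `{x, y}`. The degree bound forces equality everywhere, so every edge at `x` or `y` is a
digon, i.e. a pair of opposite arcs (`uncovered_pair`). Exchanging matching edges spreads this to
all vertices not adjacent to both `x` and `y`. A closed ditrail of `D` through the given nonadjacent
pair, with the most vertices, absorbs digons, because `a b a` can be inserted at any visit to `a`.
Digon connections, together with a count ruling out a ditrail confined to one half of `S`, then
reach all of `S` (`mem_of_closed_under_digons`). -/

theorem exists_maximal_nat {α : Type*} (p : α → Prop) (f : α → ℕ) (N : ℕ) (hex : ∃ a, p a)
    (hN : ∀ a, p a → f a ≤ N) : ∃ a, p a ∧ ∀ b, p b → f b ≤ f a := by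
  have hne : {n | ∃ a, p a ∧ f a = n}.Nonempty := hex.imp' f fun a ha => ⟨a, ha, rfl⟩
  have hbdd : BddAbove {n | ∃ a, p a ∧ f a = n} := ⟨N, by rintro _ ⟨a, ha, rfl⟩; exact hN a ha⟩
  obtain ⟨a, ha, hfa⟩ := Nat.sSup_mem hne hbdd
  exact ⟨a, ha, fun b hb => hfa ▸ le_csSup hbdd ⟨b, hb, rfl⟩⟩

/-! ### Segments of lists and their consecutive pairs. -/

namespace List

variable {α : Type*}

theorem exists_last_satisfying {p : α → Prop} {l : List α} (h : ∃ x ∈ l, p x) :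
    ∃ u a m, l = u ++ a :: m ∧ p a ∧ ∀ z ∈ m, ¬ p z := by
  induction l with
  | nil => simp at h
  | cons c t ih =>
    by_cases ht : ∃ x ∈ t, p x
    · obtain ⟨u, a, m, rfl, ha, hm⟩ := ih ht
      exact ⟨c :: u, a, m, rfl, ha, hm⟩
    · obtain ⟨x, hx, hpx⟩ := h
      rcases List.mem_cons.1 hx with rfl | hx
      · exact ⟨[], x, t, rfl, hpx, fun z hz hpz => ht ⟨z, hz, hpz⟩⟩
      · exact absurd ⟨x, hx, hpx⟩ ht

theorem exists_first_satisfying {p : α → Prop} {l : List α} (h : ∃ x ∈ l, p x) :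
    ∃ u a m, l = u ++ a :: m ∧ p a ∧ ∀ z ∈ u, ¬ p z := by
  obtain ⟨u, a, m, hl, ha, hm⟩ := exists_last_satisfying (l := l.reverse) (p := p) (by simpa using h)
  refine ⟨m.reverse, a, u.reverse, ?_, ha, by simpa using hm⟩
  rw [← List.reverse_reverse l, hl]
  simp

/-- A list starting in `p` and meeting `q` has a segment from `p` to `q` whose interior avoids
both. -/
theorem exists_segment {p q : α → Prop} (hpq : ∀ x, p x → ¬ q x) {c : α} {t : List α} (hc : p c)
    (hq : ∃ x ∈ c :: t, q x) :
    ∃ u a m b v, c :: t = u ++ a :: (m ++ b :: v) ∧ p a ∧ q b ∧ ∀ z ∈ m, ¬ p z ∧ ¬ q z := by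
  obtain ⟨s, b, v, hs, hb, hsq⟩ := exists_first_satisfying hq
  have hcs : c ∈ s := by
    cases s with
    | nil =>
      simp only [nil_append, cons.injEq] at hs
      exact absurd (hs.1 ▸ hb) (hpq c hc)
    | cons d s => simp at hs; simp [hs.1]
  obtain ⟨u, a, m, rfl, ha, hm⟩ := exists_last_satisfying ⟨c, hcs, hc⟩
  exact ⟨u, a, m, b, v, by simp [hs], ha, hb, fun z hz => ⟨hm z hz, hsq z (by simp [hz])⟩⟩

/-- The list of pairs of consecutive entries. -/
def arcs (l : List α) : List (α × α) := l.zip l.tail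

@[simp] theorem arcs_singleton (a : α) : arcs [a] = [] := rfl

@[simp] theorem arcs_cons_cons (a b : α) (l : List α) : arcs (a :: b :: l) = (a, b) :: arcs (b :: l) :=
  rfl

theorem arcs_append_cons (u : List α) (a : α) (v : List α) :
    arcs (u ++ a :: v) = arcs (u ++ [a]) ++ arcs (a :: v) := by
  induction u with
  | nil => simp
  | cons c u ih =>
    cases u with
    | nil => simp
    | cons d u => simpa using ih

theorem mem_of_mem_arcs {l : List α} {e : α × α} (he : e ∈ arcs l) : e.1 ∈ l ∧ e.2 ∈ l := by
  have := List.of_mem_zip (a := e.1) (b := e.2) he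
  exact ⟨this.1, List.mem_of_mem_tail this.2⟩

theorem map_fst_arcs (l : List α) : (arcs l).map Prod.fst = l.dropLast := by
  induction l with
  | nil => rfl
  | cons a l ih =>
    cases l with
    | nil => rfl
    | cons b l => simpa using ih

/-- Arcs with distinct tails are distinct. The last entry is the tail of no arc, so it may repeat an
earlier one, as in a cycle. -/
theorem nodup_arcs_of_nodup_dropLast {l : List α} (h : l.dropLast.Nodup) : (arcs l).Nodup :=
  List.Nodup.of_map Prod.fst (by rwa [map_fst_arcs])

theorem arcs_map {β : Type*} (f : α → β) (l : List α) :
    arcs (l.map f) = (arcs l).map (Prod.map f f) := by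
  rw [arcs, arcs, ← List.map_tail, List.zip_map]

end List

/-! ### Surgery on closed ditrails. -/

namespace Digraph

open List

variable {V : Type*} {D : Digraph V}

theorem IsClosedDitrail.map {W : Type*} {E : Digraph W} {l : List V} (hl : D.IsClosedDitrail l)
    (f : V → W) (hf : Function.Injective f) (hadj : ∀ a b, D.Adj a b → E.Adj (f a) (f b)) :
    E.IsClosedDitrail (l.map f) where
  ne_nil := by simpa using hl.ne_nil
  isChain := isChain_map_of_isChain f hadj hl.isChain
  arcs_nodup := by
    change (arcs _).Nodup
    rw [arcs_map]
    exact Nodup.map (hf.prodMap hf) hl.arcs_nodup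
  closed := by simp [hl.closed]

/-- A closed ditrail can be traversed starting from any of its vertices. -/
theorem IsClosedDitrail.exists_rotate {l : List V} (hl : D.IsClosedDitrail l) {a : V}
    (ha : a ∈ l) : ∃ t, D.IsClosedDitrail (a :: t) ∧ ∀ x, x ∈ a :: t ↔ x ∈ l := by
  obtain ⟨u, v, rfl⟩ := append_of_mem ha
  cases u with
  | nil => exact ⟨v, hl, fun _ => Iff.rfl⟩
  | cons c u =>
    rcases eq_nil_or_concat v with rfl | ⟨v, d, rfl⟩
    · have hc : c = a := by
        have := hl.closed
        rw [getLast?_concat] at this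
        simpa using this
      subst hc
      exact ⟨u ++ [c], hl, fun _ => Iff.rfl⟩
    · obtain rfl : c = d := by
        have := hl.closed
        rw [show c :: u ++ a :: (v.concat d) = (c :: u ++ a :: v) ++ [d] by simp,
          getLast?_concat] at this
        simpa using this
      have hch := hl.isChain
      have hnd : (arcs _).Nodup := hl.arcs_nodup
      rw [isChain_split] at hch
      rw [arcs_append_cons] at hnd
      refine ⟨v ++ c :: (u ++ [a]), ⟨⟨by simp, ?_, ?_⟩, ?_⟩, fun x => ?_⟩
      · rw [← cons_append, isChain_split]
        exact ⟨by simpa using hch.2, by simpa using hch.1⟩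
      · change (arcs _).Nodup
        rw [← cons_append, arcs_append_cons]
        refine (perm_append_comm.nodup_iff).1 ?_
        simpa using hnd
      · rw [show a :: (v ++ c :: (u ++ [a])) = (a :: (v ++ c :: u)) ++ [a] by simp,
          getLast?_concat]
        rfl
      · simp; tauto

/-- Joining two arc-disjoint ditrails by a path through new vertices. -/
theorem isDitrail_detour {u v P : List V} {a b : V} (hu : (u ++ [a]).IsChain D.Adj)
    (hv : (b :: v).IsChain D.Adj) (hnd : (arcs (u ++ [a]) ++ arcs (b :: v)).Nodup)
    (hP : P ≠ []) (hPnd : P.Nodup) (hPch : (a :: (P ++ [b])).IsChain D.Adj)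
    (hPu : ∀ x ∈ P, x ∉ u ++ [a]) (hPv : ∀ x ∈ P, x ∉ b :: v) :
    D.IsDitrail (u ++ a :: (P ++ b :: v)) := by
  -- Every inserted arc touches a new vertex, so it cannot repeat an old arc. This needs `P ≠ []`,
  -- as the bare arc `(a, b)` might already be used.
  have key : ∀ e ∈ arcs (a :: (P ++ [b])), e.1 ∈ P ∨ e.2 ∈ P := by
    intro e he
    obtain ⟨p, P, rfl⟩ := exists_cons_of_ne_nil hP
    rw [cons_append, arcs_cons_cons] at he
    rcases mem_cons.1 he with rfl | he
    · simp
    · left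
      have := mem_map_of_mem (f := Prod.fst) he
      rw [map_fst_arcs, ← cons_append, dropLast_concat] at this
      exact this
  refine ⟨by simp, ?_, ?_⟩
  · rw [isChain_split, ← cons_append, isChain_split (c := b)]
    exact ⟨hu, hPch, hv⟩
  · change (arcs _).Nodup
    rw [arcs_append_cons, ← cons_append, arcs_append_cons _ b, cons_append]
    rw [nodup_append'] at hnd
    rw [nodup_append', nodup_append']
    refine ⟨hnd.1, ⟨nodup_arcs_of_nodup_dropLast ?_, hnd.2.1, ?_⟩, ?_⟩
    · rw [← cons_append, dropLast_concat, nodup_cons]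
      exact ⟨fun h => hPu a h (by simp), hPnd⟩
    · intro e he he'
      have := mem_of_mem_arcs he'
      exact (key e he).elim (fun h => hPv _ h this.1) fun h => hPv _ h this.2
    · intro e he he'
      rcases mem_append.1 he' with he' | he'
      · have := mem_of_mem_arcs he
        exact (key e he').elim (fun h => hPu _ h this.1) fun h => hPu _ h this.2
      · exact hnd.2.2 he he'

theorem IsClosedDitrail.detour {u m v P : List V} {a b : V}
    (hl : D.IsClosedDitrail (u ++ a :: (m ++ b :: v)))
    (hP : P ≠ []) (hPnd : P.Nodup) (hPch : (a :: (P ++ [b])).IsChain D.Adj)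
    (hPl : ∀ x ∈ P, x ∉ u ++ a :: (m ++ b :: v)) :
    D.IsClosedDitrail (u ++ a :: (P ++ b :: v)) := by
  have hch := hl.isChain
  have hnd : (arcs _).Nodup := hl.arcs_nodup
  rw [isChain_split, ← cons_append, isChain_split (c := b)] at hch
  rw [arcs_append_cons, ← cons_append, arcs_append_cons _ b] at hnd
  refine ⟨isDitrail_detour hch.1 hch.2.2 (hnd.sublist ?_) hP hPnd hPch ?_ ?_, ?_⟩
  · exact (Sublist.refl _).append (sublist_append_right _ _)
  · intro x hx h
    exact hPl x hx (by simp at h ⊢; tauto)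
  · intro x hx h
    exact hPl x hx (by simp at h ⊢; tauto)
  · have := hl.closed
    simp only [getLast?_append, head?_append, getLast?_cons, head?_cons] at this ⊢
    simpa using this

/-- Unlike a detour, this loses no vertex: `a` is simply visited once more, which ditrails allow and
cycles do not. -/
theorem IsClosedDitrail.insert {u v P : List V} {a : V} (hl : D.IsClosedDitrail (u ++ a :: v))
    (hP : P ≠ []) (hPnd : P.Nodup) (hPch : (a :: (P ++ [a])).IsChain D.Adj)
    (hPl : ∀ x ∈ P, x ∉ u ++ a :: v) :
    D.IsClosedDitrail (u ++ a :: (P ++ a :: v)) := by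
  have hch := hl.isChain
  have hnd : (arcs _).Nodup := hl.arcs_nodup
  rw [isChain_split] at hch
  rw [arcs_append_cons] at hnd
  refine ⟨isDitrail_detour hch.1 hch.2 hnd hP hPnd hPch ?_ ?_, ?_⟩
  · intro x hx h
    exact hPl x hx (by simp at h ⊢; tauto)
  · intro x hx h
    exact hPl x hx (by simp at h ⊢; tauto)
  · have := hl.closed
    simp only [getLast?_append, head?_append, getLast?_cons, head?_cons] at this ⊢
    simpa using this

/-! ### Digraphs on at most `2k + 1` vertices. -/

/-- A path in `R` that can be extended in `R` at neither end. -/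
theorem exists_longest_path [Finite V] (D : Digraph V) {R : Set V} (hR : R.Nonempty) :
    ∃ P : List V, ∃ hP : P ≠ [], P.Nodup ∧ P.IsChain D.Adj ∧ (∀ x ∈ P, x ∈ R) ∧
      (∀ x ∈ R, D.Adj x (P.head hP) → x ∈ P) ∧ (∀ x ∈ R, D.Adj (P.getLast hP) x → x ∈ P) := by
  have := Fintype.ofFinite V
  obtain ⟨r, hr⟩ := hR
  obtain ⟨P, ⟨hP, hnd, hch, hPR⟩, hmax⟩ := exists_maximal_nat
    (fun P : List V => P ≠ [] ∧ P.Nodup ∧ P.IsChain D.Adj ∧ ∀ x ∈ P, x ∈ R) List.length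
    (Fintype.card V) ⟨[r], by simpa using hr⟩ fun P hP => hP.2.1.length_le_card
  refine ⟨P, hP, hnd, hch, hPR, fun x hx hadj => ?_, fun x hx hadj => ?_⟩
  · by_contra hxP
    have := hmax (x :: P) ⟨by simp, by simp [hxP, hnd], ?_, by simpa [hx] using hPR⟩
    · simp at this
    · rw [isChain_cons]
      exact ⟨fun y hy => by rw [head?_eq_some_head hP] at hy; simp_all, hch⟩
  · by_contra hxP
    have := hmax (P ++ [x]) ⟨by simp, ?_, ?_, ?_⟩
    · simp at this
    · rw [nodup_append']; simp [hnd, hxP]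
    · rw [isChain_append]
      refine ⟨hch, by simp, fun y hy z hz => ?_⟩
      rw [getLast?_eq_some_getLast hP] at hy
      simp_all
    · simpa [or_imp, forall_and, hx] using hPR

/-- A digraph with minimum out-degree at least `k ≥ 1` has a cycle on more than `k` vertices. -/
theorem exists_isClosedDitrail_lt_card [Fintype V] [DecidableEq V] [Nonempty V] {k : ℕ}
    (hk : 0 < k) (hout : ∀ v, k ≤ D.outDeg v) :
    ∃ l, D.IsClosedDitrail l ∧ k < l.toFinset.card := by
  obtain ⟨P, hP, hnd, hch, -, -, hlast⟩ := D.exists_longest_path (R := Set.univ) Set.univ_nonempty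
  set z := P.getLast hP with hz
  have hmem : ∀ x, D.Adj z x → x ∈ P := fun x hx => hlast x trivial hx
  obtain ⟨x, hxz, hx⟩ : (D.outNbhd z).Nonempty :=
    Set.nonempty_of_ncard_ne_zero (by have := hout z; unfold outDeg at this; omega)
  -- All out-neighbours of the last vertex `z` lie on `P`. Closing up at the earliest of them gives
  -- a cycle through `z` and all of them.
  obtain ⟨u, a, m, hPu, ha, hu⟩ :=
    exists_first_satisfying (p := fun x => x ≠ z ∧ D.Adj z x) ⟨x, hmem x hx, hxz, hx⟩
  have hzlast : (a :: m).getLast (by simp) = z := by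
    rw [hz]; simp only [hPu]; rw [getLast_append_of_right_ne_nil]
  have hzm : z ∈ a :: m := hzlast ▸ getLast_mem _
  rw [hPu] at hnd hch
  have hch' := (isChain_append.1 hch).2.1
  have hnd' := (nodup_append'.1 hnd).2.1
  refine ⟨a :: m ++ [a], ⟨⟨by simp, ?_, ?_⟩, ?_⟩, ?_⟩
  · rw [isChain_append]
    refine ⟨hch', by simp, fun y hy w hw => ?_⟩
    rw [getLast?_eq_some_getLast (by simp), hzlast] at hy
    simp only [Option.mem_def, Option.some.injEq, head?_cons] at hy hw
    rw [← hy, ← hw]; exact ha.2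
  · exact nodup_arcs_of_nodup_dropLast (by rwa [dropLast_concat])
  · rw [getLast?_concat]; rfl
  · have hsub : insert z (D.outNbhd z) ⊆ ((a :: m ++ [a]).toFinset : Set V) := by
      rintro y (rfl | hy)
      · simp only [coe_toFinset, Set.mem_ofPred_eq]; exact mem_append_left _ hzm
      · have h1 := hmem y hy.2
        rw [hPu] at h1
        rcases mem_append.1 h1 with h | h
        · exact absurd hy (hu y h)
        · simp only [coe_toFinset, Set.mem_ofPred_eq]; exact mem_append_left _ h
    have h1 := Set.ncard_le_ncard hsub (Finset.finite_toSet _)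
    rw [Set.ncard_coe_finset, Set.ncard_insert_of_notMem (by simp [outNbhd])] at h1
    have := hout z
    unfold outDeg at this
    omega

/-- A digraph on at most `2 k + 1` vertices whose semi-degrees are all at least `k ≥ 1` has a
spanning closed ditrail. -/
theorem exists_spanning_isClosedDitrail [Finite V] [Nonempty V] {k : ℕ} (hk : 0 < k)
    (hcard : Nat.card V ≤ 2 * k + 1) (hout : ∀ v, k ≤ D.outDeg v) (hin : ∀ v, k ≤ D.inDeg v) :
    ∃ l, D.IsClosedDitrail l ∧ ∀ v, v ∈ l := by
  classical
  have := Fintype.ofFinite V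
  rw [Nat.card_eq_fintype_card] at hcard
  obtain ⟨l₀, hl₀, hkl₀⟩ := exists_isClosedDitrail_lt_card hk hout
  obtain ⟨l, hl, hmax⟩ := exists_maximal_nat D.IsClosedDitrail (fun l => l.toFinset.card)
    (Fintype.card V) ⟨l₀, hl₀⟩ fun l _ => Finset.card_le_univ _
  have hkl : k < l.toFinset.card := hkl₀.trans_le (hmax l₀ hl₀)
  refine ⟨l, hl, ?_⟩
  by_contra! hR
  obtain ⟨P, hP, hPnd, hPch, hPR, hhead, hlast⟩ := D.exists_longest_path (R := {x | x ∉ l}) hR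
  set A : Finset V := l.toFinset.filter fun x => D.Adj x (P.head hP) with hA
  set B : Finset V := l.toFinset.filter fun x => D.Adj (P.getLast hP) x with hB
  have hPcard : P.toFinset.card = P.length := toFinset_card_of_nodup hPnd
  have hPpos : 0 < P.length := length_pos_iff.2 hP
  have hdisj : Disjoint l.toFinset P.toFinset := by
    rw [Finset.disjoint_left]
    intro x hx hxP
    exact hPR x (by simpa using hxP) (by simpa using hx)
  have hlP : l.toFinset.card + P.length ≤ Fintype.card V := by
    rw [← hPcard, ← Finset.card_union_of_disjoint hdisj]
    exact Finset.card_le_univ _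
  -- Any in-neighbour of the head is on `l` or among the other `|P| - 1` vertices of `P`.
  have hAcard : k + 1 ≤ A.card + P.length := by
    have hsub : D.inNbhd (P.head hP) ⊆ (A ∪ P.toFinset.erase (P.head hP) : Finset V) := by
      intro x hx
      by_cases hxl : x ∈ l
      · simp [hA, hxl, hx.2]
      · simp [hx.1, hhead x hxl hx.2]
    have h1 := Set.ncard_le_ncard hsub (Finset.finite_toSet _)
    rw [Set.ncard_coe_finset] at h1
    have h2 := Finset.card_union_le A (P.toFinset.erase (P.head hP))
    rw [Finset.card_erase_of_mem (by simp), hPcard] at h2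
    have := hin (P.head hP)
    unfold inDeg at this
    omega
  have hBcard : k + 1 ≤ B.card + P.length := by
    have hsub : D.outNbhd (P.getLast hP) ⊆ (B ∪ P.toFinset.erase (P.getLast hP) : Finset V) := by
      intro x hx
      by_cases hxl : x ∈ l
      · simp [hB, hxl, hx.2]
      · simp [hx.1, hlast x hxl hx.2]
    have h1 := Set.ncard_le_ncard hsub (Finset.finite_toSet _)
    rw [Set.ncard_coe_finset] at h1
    have h2 := Finset.card_union_le B (P.toFinset.erase (P.getLast hP))
    rw [Finset.card_erase_of_mem (by simp), hPcard] at h2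
    have := hout (P.getLast hP)
    unfold outDeg at this
    omega
  have hpath : ∀ a b, a ∈ A → b ∈ B → (a :: (P ++ [b])).IsChain D.Adj := by
    intro a b ha hb
    have ha' : D.Adj a (P.head hP) := (Finset.mem_filter.1 ha).2
    have hb' : D.Adj (P.getLast hP) b := (Finset.mem_filter.1 hb).2
    rw [← cons_append, isChain_append, isChain_cons]
    refine ⟨⟨fun y hy => ?_, hPch⟩, by simp, fun y hy z hz => ?_⟩
    · rw [head?_eq_some_head hP] at hy; simp_all
    · rw [getLast?_cons_of_ne_nil hP, getLast?_eq_some_getLast hP] at hy; simp_all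
  have hPl : ∀ x ∈ P, x ∉ l := hPR
  have hAB : ∀ x, x ∈ A → x ∉ B := by
    intro a haA haB
    have hal : a ∈ l := by simpa using (Finset.mem_filter.1 haA).1
    obtain ⟨u, v, huv⟩ := append_of_mem hal
    have hnew := hmax _ ((huv ▸ hl).insert hP hPnd (hpath a a haA haB) (huv ▸ hPl))
    have hsub : l.toFinset ∪ P.toFinset ⊆ (u ++ a :: (P ++ a :: v)).toFinset := by
      intro x; simp [huv]; tauto
    have := Finset.card_le_card hsub
    rw [Finset.card_union_of_disjoint hdisj] at this
    omega
  -- Since `|l| ≥ k + 1`, the path has at most `k` vertices, so the bounds above are positive.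
  obtain ⟨a₀, ha₀⟩ : A.Nonempty := Finset.card_pos.1 (by omega)
  obtain ⟨b₀, hb₀⟩ : B.Nonempty := Finset.card_pos.1 (by omega)
  have hAl : ∀ x, x ∈ A → x ∈ l := fun x hx => by simpa using (Finset.mem_filter.1 hx).1
  have hBl : ∀ x, x ∈ B → x ∈ l := fun x hx => by simpa using (Finset.mem_filter.1 hx).1
  obtain ⟨t, ht, htl⟩ := hl.exists_rotate (hAl _ ha₀)
  obtain ⟨u, a, m, b, v, heq, ha, hb, hm⟩ := exists_segment (p := (· ∈ A)) (q := (· ∈ B)) hAB ha₀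
    ⟨b₀, (htl _).2 (hBl _ hb₀), hb₀⟩
  have htP : ∀ x ∈ P, x ∉ a₀ :: t := fun x hx h => hPl x hx ((htl x).1 h)
  have hnew := hmax _ ((heq ▸ ht).detour hP hPnd (hpath a b ha hb) (heq ▸ htP))
  have hkeep : ∀ x ∈ l, x ∉ m → x ∈ u ++ a :: (P ++ b :: v) := by
    intro x hx hxm
    have := (htl x).2 hx
    rw [heq] at this
    simp at this ⊢
    tauto
  -- The discarded interior avoids `A ∪ B`, so the new ditrail has at least `2(k + 1 - |P|) + |P|`
  -- vertices. By maximality `|l| + |P| ≥ 2k + 2`, which is too many.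
  have hsub : (A ∪ B) ∪ P.toFinset ⊆ (u ++ a :: (P ++ b :: v)).toFinset := by
    intro x hx
    rw [mem_toFinset]
    rcases Finset.mem_union.1 hx with hx | hx
    · rcases Finset.mem_union.1 hx with hx | hx
      · exact hkeep x (hAl x hx) fun h => (hm x h).1 hx
      · exact hkeep x (hBl x hx) fun h => (hm x h).2 hx
    · simp at hx ⊢; tauto
  have h1 := Finset.card_le_card hsub
  rw [Finset.card_union_of_disjoint, Finset.card_union_of_disjoint (Finset.disjoint_left.2 hAB),
    hPcard] at h1
  · omega
  · refine hdisj.mono_left fun x hx => ?_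
    rw [mem_toFinset]
    exact (Finset.mem_union.1 hx).elim (hAl x) (hBl x)

end Digraph

/-! ### Matchings as lists of pairs, and exchanges. -/

namespace SimpleGraph

open List

variable {V : Type*} {G : SimpleGraph V}

/-- The list of all ends of a list of pairs. -/
def pairEnds (L : List (V × V)) : List V := L.flatMap fun e => [e.1, e.2]

@[simp] theorem pairEnds_nil : pairEnds ([] : List (V × V)) = [] := rfl

@[simp] theorem pairEnds_cons (e : V × V) (L : List (V × V)) :
    pairEnds (e :: L) = e.1 :: e.2 :: pairEnds L := rfl

theorem pairEnds_perm {L L' : List (V × V)} (h : L.Perm L') : (pairEnds L).Perm (pairEnds L') :=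
  h.flatMap_right _

theorem length_pairEnds (L : List (V × V)) : (pairEnds L).length = 2 * L.length := by
  induction L with
  | nil => rfl
  | cons e L ih => simp [ih]; omega

/-- A matching of `G`, given as a list of pairs. -/
structure IsMatchingList (G : SimpleGraph V) (L : List (V × V)) : Prop where
  nodup : (pairEnds L).Nodup
  adj : ∀ e ∈ L, G.Adj e.1 e.2

theorem IsMatchingList.perm {L L' : List (V × V)} (hL : G.IsMatchingList L) (h : L.Perm L') :
    G.IsMatchingList L' :=
  ⟨(pairEnds_perm h).nodup_iff.1 hL.nodup, fun e he => hL.adj e (h.mem_iff.2 he)⟩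

theorem IsMatchingList.exists_subgraph {L : List (V × V)} (hL : G.IsMatchingList L) :
    ∃ M : G.Subgraph, M.IsMatching ∧ M.edgeSet.Finite ∧ M.edgeSet.ncard = L.length ∧
      ∀ v, v ∈ M.verts ↔ v ∈ pairEnds L := by
  induction L with
  | nil => exact ⟨⊥, by simp [Subgraph.IsMatching]⟩
  | cons e L ih =>
    have hnd := hL.nodup
    simp only [pairEnds_cons, nodup_cons, mem_cons, not_or] at hnd
    obtain ⟨M, hM, hfin, hcard, hverts⟩ :=
      ih ⟨hnd.2.2, fun e he => hL.adj e (mem_cons_of_mem _ he)⟩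
    have he := hL.adj e mem_cons_self
    refine ⟨M ⊔ G.subgraphOfAdj he, hM.sup (Subgraph.IsMatching.subgraphOfAdj he) ?_, ?_, ?_, ?_⟩
    · rw [hM.support_eq_verts, support_subgraphOfAdj, Set.disjoint_left]
      rintro v hv (rfl | rfl)
      · exact hnd.1.2 ((hverts _).1 hv)
      · exact hnd.2.1 ((hverts _).1 hv)
    · simp [hfin]
    · have hnot : s(e.1, e.2) ∉ M.edgeSet := fun h => hnd.1.2 ((hverts _).1 (M.edge_vert h))
      rw [Subgraph.edgeSet_sup, edgeSet_subgraphOfAdj, Set.union_singleton,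
        Set.ncard_insert_of_notMem hnot hfin, hcard, length_cons]
    · intro v
      simp [hverts]

theorem Subgraph.IsMatching.exists_isMatchingList [Finite V] {M : G.Subgraph}
    (hM : M.IsMatching) : ∃ L, G.IsMatchingList L ∧ L.length = M.edgeSet.ncard := by
  classical
  have hfin : M.edgeSet.Finite := Set.toFinite _
  refine ⟨hfin.toFinset.toList.map Quot.out, ⟨?_, ?_⟩, ?_⟩
  · have hout : ∀ e : Sym2 V, s(e.out.1, e.out.2) = e := fun e => by
      simp [Sym2.mk, Prod.mk.eta]
    rw [pairEnds, flatMap_map, nodup_flatMap]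
    refine ⟨fun e he => ?_, ?_⟩
    · have he' : e ∈ M.edgeSet := by simpa using he
      rw [← hout e] at he'
      simpa using M.adj_sub he' |>.ne
    · refine (Finset.nodup_toList _).imp_of_mem fun {e f} he hf hne v hve hvf => hne ?_
      have he' : e ∈ M.edgeSet := by simpa using he
      have hf' : f ∈ M.edgeSet := by simpa using hf
      have hve' : v ∈ e := by
        rw [← hout e]; simpa using hve
      have hvf' : v ∈ f := by
        rw [← hout f]; simpa using hvf
      obtain ⟨w, rfl⟩ := Sym2.mem_iff_exists.1 hve'
      obtain ⟨z, rfl⟩ := Sym2.mem_iff_exists.1 hvf'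
      have hvM : v ∈ M.verts := M.edge_vert he'
      exact congrArg (fun t => s(v, t)) ((hM hvM).unique he' hf')
  · intro e he
    obtain ⟨f, hf, rfl⟩ := List.mem_map.1 he
    have hf' : f ∈ M.edgeSet := by simpa using hf
    have hout : s((Quot.out f).1, (Quot.out f).2) = f := by simp [Sym2.mk, Prod.mk.eta]
    rw [← hout] at hf'
    exact M.adj_sub hf'
  · simp [Set.ncard_eq_toFinset_card _ hfin]

theorem mem_pairEnds_of_adj {k : ℕ} (hmax : ∀ L, G.IsMatchingList L → L.length ≤ k)
    {L : List (V × V)} (hL : G.IsMatchingList L) (hlen : L.length = k)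
    {x z : V} (hx : x ∉ pairEnds L) (hxz : G.Adj x z) :
    z ∈ pairEnds L := by
  by_contra hz
  have := hmax ((x, z) :: L) ⟨by simp [hx, hz, hL.nodup, hxz.ne],
    by simpa [hxz] using fun a b h => hL.adj (a, b) h⟩
  simp at this
  omega

/-- Otherwise `x a b y` is an augmenting path: replacing `ab` by `xa` and `yb` gives a larger
matching. -/
theorem not_adj_and_adj {k : ℕ} (hmax : ∀ L, G.IsMatchingList L → L.length ≤ k)
    {L : List (V × V)} (hL : G.IsMatchingList L) (hlen : L.length = k)
    {x y a b : V} (hx : x ∉ pairEnds L) (hy : y ∉ pairEnds L) (hxy : x ≠ y)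
    (hab : (a, b) ∈ L) : ¬ (G.Adj x a ∧ G.Adj y b) := by
  rintro ⟨hxa, hyb⟩
  obtain ⟨u, v, rfl⟩ := append_of_mem hab
  have hp := perm_middle (a := (a, b)) (l₁ := u) (l₂ := v)
  have hm := hL.perm hp
  rw [(pairEnds_perm hp).mem_iff] at hx hy
  have hnd := hm.nodup
  have hadj := hm.adj
  have := hmax ((x, a) :: (y, b) :: (u ++ v)) ⟨?_, ?_⟩
  · simp at this hlen
    omega
  · simp only [pairEnds_cons, nodup_cons, mem_cons, not_or] at hnd hx hy ⊢
    simp_all [eq_comm]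
  · intro e he
    rcases mem_cons.1 he with rfl | he
    · exact hxa
    rcases mem_cons.1 he with rfl | he
    · exact hyb
    · exact hadj e (mem_cons_of_mem _ he)

/-- Exchanging the matching edge `ab` for `xa`. -/
theorem exists_exchange {k : ℕ} {L : List (V × V)} (hL : G.IsMatchingList L)
    (hlen : L.length = k) {x y a b : V} (hx : x ∉ pairEnds L) (hy : y ∉ pairEnds L) (hxy : x ≠ y)
    (hab : (a, b) ∈ L ∨ (b, a) ∈ L) (hxa : G.Adj x a) :
    ∃ L', G.IsMatchingList L' ∧ L'.length = k ∧ b ∉ pairEnds L' ∧ y ∉ pairEnds L' ∧ b ≠ y := by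
  obtain ⟨L₁, hperm, hadj⟩ : ∃ L₁, (pairEnds L).Perm (a :: b :: pairEnds L₁) ∧
      (∀ e ∈ L₁, G.Adj e.1 e.2) := by
    rcases hab with hab | hab <;> obtain ⟨u, v, rfl⟩ := append_of_mem hab
    · exact ⟨u ++ v, pairEnds_perm perm_middle,
        fun e he => hL.adj e (by simp at he ⊢; tauto)⟩
    · exact ⟨u ++ v, (pairEnds_perm perm_middle).trans (Perm.swap _ _ _),
        fun e he => hL.adj e (by simp at he ⊢; tauto)⟩
  have hl := hperm.length_eq
  have hnd := hperm.nodup_iff.1 hL.nodup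
  rw [hperm.mem_iff] at hx hy
  simp only [nodup_cons, mem_cons, not_or] at hnd hx hy
  refine ⟨(x, a) :: L₁, ⟨?_, ?_⟩, ?_, ?_, ?_, fun h => hy.2.1 h.symm⟩
  · simp [hx, hnd]
  · intro e he
    rcases mem_cons.1 he with rfl | he
    exacts [hxa, hadj e he]
  · simp only [length_cons, length_pairEnds] at hl ⊢
    omega
  · simp [hnd, Ne.symm hx.2.1, Ne.symm hnd.1.1]
  · simp [hy, hxy.symm]

open Classical in
-- Of the four possible edges from `{x, y}` to `{a, b}`, each of the two disjoint pairs `xa, yb` and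
-- `ya, xb` contributes at most one.
theorem countP_add_countP_le {x y : V} {L : List (V × V)}
    (h : ∀ a b, (a, b) ∈ L → ¬ (G.Adj x a ∧ G.Adj y b) ∧ ¬ (G.Adj y a ∧ G.Adj x b)) :
    (pairEnds L).countP (G.Adj x ·) + (pairEnds L).countP (G.Adj y ·) ≤ 2 * L.length := by
  induction L with
  | nil => simp
  | cons e L ih =>
    have h1 := ih fun a b hab => h a b (mem_cons_of_mem _ hab)
    have h2 := h e.1 e.2 mem_cons_self
    simp only [pairEnds_cons, countP_cons, length_cons, decide_eq_true_eq]
    by_cases hx1 : G.Adj x e.1 <;> by_cases hx2 : G.Adj x e.2 <;> by_cases hy1 : G.Adj y e.1 <;>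
      by_cases hy2 : G.Adj y e.2 <;> simp_all <;> omega

end SimpleGraph

/-! ### Two uncovered vertices: digons everywhere needed. -/

namespace Digraph

open List SimpleGraph

variable {V : Type*} {D : Digraph V}

theorem outNbhd_subset_neighborSet (D : Digraph V) (x : V) :
    D.outNbhd x ⊆ D.toSimpleGraphInclusive.neighborSet x :=
  fun _ hz => ⟨hz.1.symm, Or.inl hz.2⟩

theorem inNbhd_subset_neighborSet (D : Digraph V) (x : V) :
    D.inNbhd x ⊆ D.toSimpleGraphInclusive.neighborSet x :=
  fun _ hz => ⟨hz.1.symm, Or.inr hz.2⟩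

/-- If `x` and `y` are uncovered by a maximum matching of size `k`, and all semi-degrees are at
least `k`, then `x` has exactly `k` neighbours and is joined to each of them by arcs in both
directions; moreover each matching edge receives exactly two edges from `{x, y}`. -/
theorem uncovered_pair [Finite V] {k : ℕ} (hout : ∀ v, k ≤ D.outDeg v) (hin : ∀ v, k ≤ D.inDeg v)
    (hmax : ∀ L, D.toSimpleGraphInclusive.IsMatchingList L → L.length ≤ k) {L : List (V × V)}
    (hL : D.toSimpleGraphInclusive.IsMatchingList L) (hlen : L.length = k) {x y : V}
    (hx : x ∉ pairEnds L) (hy : y ∉ pairEnds L) (hxy : x ≠ y) :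
    (∀ z, D.toSimpleGraphInclusive.Adj x z → D.Adj x z ∧ D.Adj z x) ∧
    (D.toSimpleGraphInclusive.neighborSet x).ncard = k ∧
    ∀ a b, (a, b) ∈ L →
      (D.toSimpleGraphInclusive.Adj x a ∧ ¬ D.toSimpleGraphInclusive.Adj x b ∧
        D.toSimpleGraphInclusive.Adj y a ∧ ¬ D.toSimpleGraphInclusive.Adj y b) ∨
      (¬ D.toSimpleGraphInclusive.Adj x a ∧ D.toSimpleGraphInclusive.Adj x b ∧
        ¬ D.toSimpleGraphInclusive.Adj y a ∧ D.toSimpleGraphInclusive.Adj y b) ∨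
      (D.toSimpleGraphInclusive.Adj x a ∧ D.toSimpleGraphInclusive.Adj x b ∧
        ¬ D.toSimpleGraphInclusive.Adj y a ∧ ¬ D.toSimpleGraphInclusive.Adj y b) ∨
      (¬ D.toSimpleGraphInclusive.Adj x a ∧ ¬ D.toSimpleGraphInclusive.Adj x b ∧
        D.toSimpleGraphInclusive.Adj y a ∧ D.toSimpleGraphInclusive.Adj y b) := by
  classical
  set G := D.toSimpleGraphInclusive with hG
  have hnadj : ∀ a b, (a, b) ∈ L → ¬ (G.Adj x a ∧ G.Adj y b) ∧ ¬ (G.Adj y a ∧ G.Adj x b) :=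
    fun a b hab => ⟨not_adj_and_adj hmax hL hlen hx hy hxy hab,
      not_adj_and_adj hmax hL hlen hy hx hxy.symm hab⟩
  have hle : ∀ w, w ∉ pairEnds L → (G.neighborSet w).ncard ≤ (pairEnds L).countP (G.Adj w ·) := by
    intro w hw
    have hsub : G.neighborSet w ⊆ (((pairEnds L).filter (G.Adj w ·)).toFinset : Set V) := by
      intro z hz
      simpa using ⟨mem_pairEnds_of_adj hmax hL hlen hw hz, hz⟩
    refine (Set.ncard_le_ncard hsub (Finset.finite_toSet _)).trans ?_
    rw [Set.ncard_coe_finset, countP_eq_length_filter]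
    exact toFinset_card_le _
  have hge : ∀ w, k ≤ (G.neighborSet w).ncard := fun w =>
    (hout w).trans (Set.ncard_le_ncard (D.outNbhd_subset_neighborSet w))
  have hsum := countP_add_countP_le hnadj
  have hlx := hle x hx
  have hly := hle y hy
  have hgx := hge x
  have hgy := hge y
  -- Both degrees are at least `k` and sum to at most `2k`. The in- and out-neighbourhoods then fill
  -- the whole neighbourhood.
  have hcard : (G.neighborSet x).ncard = k := by omega
  have houtx : D.outNbhd x = G.neighborSet x :=
    Set.eq_of_subset_of_ncard_le (D.outNbhd_subset_neighborSet x) (hcard ▸ hout x)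
  have hinx : D.inNbhd x = G.neighborSet x :=
    Set.eq_of_subset_of_ncard_le (D.inNbhd_subset_neighborSet x) (hcard ▸ hin x)
  refine ⟨fun z hz => ?_, hcard, fun a b hab => ?_⟩
  · have h1 : z ∈ D.outNbhd x := houtx ▸ hz
    have h2 : z ∈ D.inNbhd x := hinx ▸ hz
    exact ⟨h1.2, h2.2⟩
  -- The other `k - 1` matching edges receive at most `2(k - 1)` edges, so `ab` receives two; the
  -- forbidden pairs leave four patterns.
  · obtain ⟨s, t, rfl⟩ := append_of_mem hab
    have hp := perm_middle (a := (a, b)) (l₁ := s) (l₂ := t)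
    have hrest := countP_add_countP_le (G := G) (x := x) (y := y) (L := s ++ t)
      fun c d hcd => hnadj c d (by simp at hcd ⊢; tauto)
    have h0 := hnadj a b hab
    have hkx := hgx.trans hlx
    have hky := hgy.trans hly
    rw [(pairEnds_perm hp).countP_eq] at hkx hky
    clear hnadj hle hge hsum hlx hly hgx hgy hcard houtx hinx hmax hL hout hin
    simp only [length_append, length_cons] at hlen hrest
    simp only [pairEnds_cons, countP_cons, decide_eq_true_eq] at hkx hky
    by_cases hx1 : G.Adj x a <;> by_cases hx2 : G.Adj x b <;> by_cases hy1 : G.Adj y a <;>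
      by_cases hy2 : G.Adj y b <;> simp_all <;> omega

/-- Suppose that all semi-degrees are at least the matching number `k` and that some maximum
matching leaves two vertices uncovered. Then a set of vertices that contains two nonadjacent
vertices and is closed under passing along pairs of opposite arcs is the whole vertex set. -/
theorem mem_of_closed_under_digons [Finite V] {k : ℕ} (hout : ∀ v, k ≤ D.outDeg v)
    (hin : ∀ v, k ≤ D.inDeg v) (hk : 0 < k)
    (hmax : ∀ L, D.toSimpleGraphInclusive.IsMatchingList L → L.length ≤ k) {L : List (V × V)}
    (hL : D.toSimpleGraphInclusive.IsMatchingList L) (hlen : L.length = k) {x y : V}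
    (hx : x ∉ pairEnds L) (hy : y ∉ pairEnds L) (hxy : x ≠ y) {C : Set V}
    (hC : ∀ a b, a ∈ C → D.Adj a b → D.Adj b a → b ∈ C) {u v : V} (hu : u ∈ C) (hv : v ∈ C)
    (huv : u ≠ v) (hnuv : ¬ D.toSimpleGraphInclusive.Adj u v) (z : V) : z ∈ C := by
  set G := D.toSimpleGraphInclusive with hG
  obtain ⟨hdx, hcx, htype⟩ := uncovered_pair hout hin hmax hL hlen hx hy hxy
  obtain ⟨hdy, hcy, -⟩ := uncovered_pair hout hin hmax hL hlen hy hx hxy.symm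
  have hends : ∀ {w}, w ∈ pairEnds L → ∃ w', (w, w') ∈ L ∨ (w', w) ∈ L := by
    intro w hw
    obtain ⟨e, he, hwe⟩ := mem_flatMap.1 hw
    simp only [mem_cons, not_mem_nil, or_false] at hwe
    rcases hwe with rfl | rfl
    exacts [⟨e.2, Or.inl he⟩, ⟨e.1, Or.inr he⟩]
  have htype' : ∀ {a b}, (a, b) ∈ L ∨ (b, a) ∈ L →
      (G.Adj x a ∧ ¬ G.Adj x b ∧ G.Adj y a ∧ ¬ G.Adj y b) ∨
      (¬ G.Adj x a ∧ G.Adj x b ∧ ¬ G.Adj y a ∧ G.Adj y b) ∨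
      (G.Adj x a ∧ G.Adj x b ∧ ¬ G.Adj y a ∧ ¬ G.Adj y b) ∨
      (¬ G.Adj x a ∧ ¬ G.Adj x b ∧ G.Adj y a ∧ G.Adj y b) := by
    rintro a b (h | h)
    · exact htype a b h
    · have := htype b a h
      tauto
  -- If `w` is covered, its partner is adjacent to `x` or `y`, so an exchange gives a maximum
  -- matching missing `w` and another vertex.
  have hdig : ∀ w, ¬ (G.Adj x w ∧ G.Adj y w) → ∀ t, G.Adj w t → D.Adj w t ∧ D.Adj t w := by
    intro w hw
    by_cases hwL : w ∈ pairEnds L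
    · obtain ⟨w', hww'⟩ := hends hwL
      have h1 : (G.Adj x w' ∨ G.Adj y w') := by
        have := htype' hww'
        tauto
      rcases h1 with h1 | h1
      · obtain ⟨L', hL', hlen', hw', hy', hne⟩ := exists_exchange hL hlen hx hy hxy hww'.symm h1
        exact (uncovered_pair hout hin hmax hL' hlen' hw' hy' hne).1
      · obtain ⟨L', hL', hlen', hw', hx', hne⟩ :=
          exists_exchange hL hlen hy hx hxy.symm hww'.symm h1
        exact (uncovered_pair hout hin hmax hL' hlen' hw' hx' hne).1
    · by_cases hwx : w = x
      · exact hwx ▸ hdx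
      · exact (uncovered_pair hout hin hmax hL hlen hwL hx hwx).1
  -- Only an edge between two common neighbours of `x` and `y` can fail to be a digon; it is
  -- bypassed by the digons `ax` and `xb`.
  have hCG : ∀ a b, a ∈ C → G.Adj a b → b ∈ C := by
    intro a b ha hab
    by_cases h1 : G.Adj x a ∧ G.Adj y a
    · by_cases h2 : G.Adj x b ∧ G.Adj y b
      · have hxC := hC a x ha (hdx a h1.1).2 (hdx a h1.1).1
        exact hC x b hxC (hdx b h2.1).1 (hdx b h2.1).2
      · have := hdig b h2 a hab.symm
        exact hC a b ha this.2 this.1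
    · have := hdig a h1 b hab
      exact hC a b ha this.1 this.2
  have hCiff : ∀ {a b}, G.Adj a b → (a ∈ C ↔ b ∈ C) := fun h =>
    ⟨fun ha => hCG _ _ ha h, fun hb => hCG _ _ hb h.symm⟩
  -- If a covered vertex is a common neighbour, it links all parts and the underlying graph is
  -- connected. Otherwise each matching edge belongs wholly to `x` or wholly to `y`, and the graph
  -- may be disconnected.
  by_cases hA : ∃ a b, ((a, b) ∈ L ∨ (b, a) ∈ L) ∧ G.Adj x a ∧ G.Adj y a
  · obtain ⟨a, b, hab, hxa, hya⟩ := hA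
    have hxyC : y ∈ C ↔ x ∈ C := (hCiff hya).trans (hCiff hxa).symm
    have hall : ∀ w, w ∈ C ↔ x ∈ C := by
      intro w
      by_cases hwL : w ∈ pairEnds L
      · obtain ⟨w', hww'⟩ := hends hwL
        have hadj : G.Adj w w' := hww'.elim (hL.adj _) fun h => (hL.adj _ h).symm
        rcases htype' hww' with h | h | h | h
        · exact (hCiff h.1).symm
        · exact (hCiff hadj).trans (hCiff h.2.1).symm
        · exact (hCiff h.1).symm
        · exact (hCiff h.2.2.1).symm.trans hxyC
      · by_cases hwx : w = x
        · rw [hwx]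
        · have hxb : ¬ G.Adj x b := by
            have := htype' hab
            tauto
          have hwa : G.Adj w a := by
            have h3 := (uncovered_pair hout hin hmax hL hlen hwL hx hwx).2.2
            rcases hab with hab | hab
            · have := h3 _ _ hab
              tauto
            · have := h3 _ _ hab
              tauto
          exact (hCiff hwa).trans (hCiff hxa).symm
    exact (hall z).2 ((hall u).1 hu)
  · have hside : ∀ {a b}, (a, b) ∈ L ∨ (b, a) ∈ L →
        (G.Adj x a ∧ G.Adj x b ∧ ¬ G.Adj y a ∧ ¬ G.Adj y b) ∨
        (¬ G.Adj x a ∧ ¬ G.Adj x b ∧ G.Adj y a ∧ G.Adj y b) := by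
      intro a b hab
      have h1 := htype' hab
      have h2 : ¬ (G.Adj x a ∧ G.Adj y a) := fun h => hA ⟨a, b, hab, h⟩
      have h3 : ¬ (G.Adj x b ∧ G.Adj y b) := fun h => hA ⟨b, a, hab.symm, h⟩
      rcases h1 with h | h | h | h
      exacts [absurd ⟨h.1, h.2.2.1⟩ h2, absurd ⟨h.2.1, h.2.2.2⟩ h3, Or.inl h, Or.inr h]
    have hcover : ∀ w, w = x ∨ w = y ∨ G.Adj x w ∨ G.Adj y w := by
      intro w
      by_cases hwL : w ∈ pairEnds L
      · obtain ⟨w', hww'⟩ := hends hwL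
        rcases hside hww' with h | h
        exacts [Or.inr (Or.inr (Or.inl h.1)), Or.inr (Or.inr (Or.inr h.2.2.1))]
      -- A third uncovered `w` would have to receive a whole matching edge when paired with one of
      -- `x`, `y`, and none of it when paired with the other.
      · by_contra! h
        obtain ⟨e, he⟩ := exists_mem_of_length_pos (l := L) (by omega)
        have h1 := hside (a := e.1) (b := e.2) (Or.inl he)
        have h2 := (uncovered_pair hout hin hmax hL hlen hwL hx h.1).2.2 _ _ he
        have h3 := (uncovered_pair hout hin hmax hL hlen hwL hy h.2.1).2.2 _ _ he
        clear hside hA hCiff hCG hdig htype' htype hdx hdy hends hC hmax hout hin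
        rcases h1 with h1 | h1 <;> simp_all
    -- `C` contains `u`, its at least `k` neighbours and the nonneighbour `v`, hence `k + 2`
    -- vertices; a closed neighbourhood of size `k + 1` cannot hold it. This is where nonadjacency
    -- is needed.
    have hsmall : ∀ w, (G.neighborSet w).ncard = k → ¬ C ⊆ insert w (G.neighborSet w) := by
      intro w hw hsub
      have h1 : insert u (insert v (G.neighborSet u)) ⊆ C :=
        Set.insert_subset hu (Set.insert_subset hv fun t ht => hCG u t hu ht)
      have h2 := Set.ncard_le_ncard (h1.trans hsub)
      have h3 := Set.ncard_insert_le w (G.neighborSet w)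
      rw [Set.ncard_insert_of_notMem (by simp [huv]),
        Set.ncard_insert_of_notMem (by simpa using hnuv)] at h2
      have h4 := (hout u).trans (Set.ncard_le_ncard (D.outNbhd_subset_neighborSet u))
      rw [← hG] at h4
      omega
    have hxC : x ∈ C := by
      by_contra hxC
      refine hsmall y hcy fun w hw => ?_
      rcases hcover w with rfl | rfl | h | h
      · exact absurd hw hxC
      · exact Set.mem_insert _ _
      · exact absurd ((hCiff h).2 hw) hxC
      · exact Set.mem_insert_of_mem _ h
    have hyC : y ∈ C := by
      by_contra hyC
      refine hsmall x hcx fun w hw => ?_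
      rcases hcover w with rfl | rfl | h | h
      · exact Set.mem_insert _ _
      · exact absurd hw hyC
      · exact Set.mem_insert_of_mem _ h
      · exact absurd ((hCiff h).2 hw) hyC
    rcases hcover z with rfl | rfl | h | h
    exacts [hxC, hyC, (hCiff h).1 hxC, (hCiff h).1 hyC]

/-! ### The matching number, and ditrails saturated under digons. -/

theorem bddAbove_matching_card [Finite V] (G : SimpleGraph V) :
    BddAbove {n | ∃ M : G.Subgraph, M.IsMatching ∧ M.edgeSet.ncard = n} :=
  ⟨Nat.card (Sym2 V), by
    rintro _ ⟨M, -, rfl⟩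
    exact Set.ncard_le_card _⟩

theorem length_le_matchingNumber [Finite V] {L : List (V × V)}
    (hL : D.toSimpleGraphInclusive.IsMatchingList L) : L.length ≤ D.matchingNumber := by
  obtain ⟨M, hM, -, hcard, -⟩ := hL.exists_subgraph
  exact le_csSup (bddAbove_matching_card _) ⟨M, hM, hcard⟩

theorem exists_length_eq_matchingNumber [Finite V] (D : Digraph V) :
    ∃ L, D.toSimpleGraphInclusive.IsMatchingList L ∧ L.length = D.matchingNumber := by
  obtain ⟨M, hM, hcard⟩ := Nat.sSup_mem
    (s := {n | ∃ M : D.toSimpleGraphInclusive.Subgraph, M.IsMatching ∧ M.edgeSet.ncard = n})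
    ⟨_, ⊥, by simp [Subgraph.IsMatching], rfl⟩ (bddAbove_matching_card _)
  obtain ⟨L, hL, hlen⟩ := hM.exists_isMatchingList
  exact ⟨L, hL, hlen.trans hcard⟩

/-- If a closed ditrail passes through `u` and `v`, then so does one whose vertex set is closed under
passing along pairs of opposite arcs. -/
theorem exists_isClosedDitrail_closed_under_digons [Finite V] {l₀ : List V}
    (hl₀ : D.IsClosedDitrail l₀) {u v : V} (hu : u ∈ l₀) (hv : v ∈ l₀) :
    ∃ l, D.IsClosedDitrail l ∧ u ∈ l ∧ v ∈ l ∧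
      ∀ a b, a ∈ l → D.Adj a b → D.Adj b a → b ∈ l := by
  classical
  have := Fintype.ofFinite V
  obtain ⟨l, ⟨hl, hul, hvl⟩, hmax⟩ := exists_maximal_nat
    (fun l => D.IsClosedDitrail l ∧ u ∈ l ∧ v ∈ l) (fun l => l.toFinset.card)
    (Fintype.card V) ⟨l₀, hl₀, hu, hv⟩ fun l _ => Finset.card_le_univ _
  refine ⟨l, hl, hul, hvl, fun a b ha hab hba => ?_⟩
  by_contra hb
  obtain ⟨s, t, rfl⟩ := append_of_mem ha
  have hnew := hl.insert (P := [b]) (by simp) (by simp) (by simp [hab, hba]) (by simpa using hb)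
  have hkeep : ∀ w ∈ s ++ a :: t, w ∈ s ++ a :: ([b] ++ a :: t) := by
    intro w hw
    simp at hw ⊢
    tauto
  have hle := hmax _ ⟨hnew, hkeep u hul, hkeep v hvl⟩
  have hsub : insert b (s ++ a :: t).toFinset ⊆ (s ++ a :: ([b] ++ a :: t)).toFinset := by
    intro w hw
    rcases Finset.mem_insert.1 hw with rfl | hw
    · simp
    · exact mem_toFinset.2 (hkeep w (mem_toFinset.1 hw))
  have := Finset.card_le_card hsub
  rw [Finset.card_insert_of_notMem (mt mem_toFinset.1 hb)] at this
  omega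

end Digraph

theorem mainTheorem3 {V : Type*} [Finite V] (D : Digraph V) (hD : D.IsStrict) (S : Set V)
    (hS : D.IsStrictlyStrong S)
    (hdeg : (D.induced S).matchingNumber ≤ (D.induced S).minSemiDeg)
    (hpos : 0 < (D.induced S).matchingNumber) :
    D.IsClosedTrailable S := by
  classical
  obtain ⟨u, hu, v, hv, huv, hnuv, hnvu, l₀, hl₀, hul₀, hvl₀⟩ := hS
  have hne : Nonempty S := ⟨⟨u, hu⟩⟩
  have := Fintype.ofFinite S
  set k := (D.induced S).matchingNumber with hk
  have hout : ∀ w, k ≤ (D.induced S).outDeg w := fun w =>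
    (hdeg.trans (min_le_left _ _)).trans (ciInf_le (OrderBot.bddBelow _) w)
  have hin : ∀ w, k ≤ (D.induced S).inDeg w := fun w =>
    (hdeg.trans (min_le_right _ _)).trans (ciInf_le (OrderBot.bddBelow _) w)
  obtain ⟨L, hL, hlen⟩ := (D.induced S).exists_length_eq_matchingNumber
  by_cases hx : ∃ x y : S, x ∉ SimpleGraph.pairEnds L ∧ y ∉ SimpleGraph.pairEnds L ∧ x ≠ y
  · obtain ⟨x, y, hx, hy, hxy⟩ := hx
    obtain ⟨l, hl, hul, hvl, hclosed⟩ :=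
      Digraph.exists_isClosedDitrail_closed_under_digons hl₀ hul₀ hvl₀
    refine ⟨l, hl, fun s hs => ?_⟩
    -- The ditrail may leave `S`; only its trace on `S` enters the argument.
    exact Digraph.mem_of_closed_under_digons hout hin hpos
      (fun _ => Digraph.length_le_matchingNumber) hL hlen hx hy hxy
      (C := {w : S | (w : V) ∈ l}) (fun a b ha hab hba => hclosed a b ha hab hba)
      (u := ⟨u, hu⟩) (v := ⟨v, hv⟩) hul hvl (by simpa using huv)
      (fun h => h.2.elim hnuv hnvu) ⟨s, hs⟩
  · push Not at hx
    have hcard : Nat.card S ≤ 2 * k + 1 := by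
      have h1 : ((SimpleGraph.pairEnds L).toFinsetᶜ).card ≤ 1 := by
        rw [Finset.card_le_one]
        intro a ha b hb
        exact hx a b (by simpa using ha) (by simpa using hb)
      have h2 := List.toFinset_card_le (SimpleGraph.pairEnds L)
      rw [SimpleGraph.length_pairEnds, hlen] at h2
      have h3 := Finset.card_add_card_compl (SimpleGraph.pairEnds L).toFinset
      rw [Nat.card_eq_fintype_card]
      omega
    obtain ⟨l, hl, hall⟩ := Digraph.exists_spanning_isClosedDitrail hpos hcard hout hin
    exact ⟨l.map Subtype.val, hl.map _ Subtype.val_injective fun _ _ h => h,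
      fun s hs => List.mem_map.2 ⟨⟨s, hs⟩, hall _, rfl⟩⟩
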